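/- A group is locally indicable if each of its non-trivial finitely generated subgroups surjects onto $\mathbb Z$. Let $X$ be a 2-complex, that is, a CW complex all of whose cells have dimension at most $2$, and let $L\subseteq X$ be a subcomplex; neither $X$ nor $L$ is required to be connected. For subcomplexes $Z'\subseteq Z$ of $X$, there is an elementary collapse from $Z$ to $Z'$ if $Z=Z'\sqcup e^{n}\sqcup e^{n+1}$ for an open $n$-cell $e^n$ and an open $(n+1)$-cell $e^{n+1}$ such that $e^n$ is a free face of $e^{n+1}$: there is a characteristic map $\varphi\colon[-1,1]^{n+1}\to Z$ of $e^{n+1}$ whose restriction to the face $\{1\}\times[-1,1]^n$ is a characteristic map of $e^n$ and which maps every boundary point of the cube outside the relative interior of that face into $Z'$. A subcomplex $Z$ collapses into $L$ if a finite (possibly empty) sequence of elementary collapses leads from $Z$ to some subcomplex $Z'\subseteq L$. Assume that $\pi_1(L,y)$ is locally indicable for every $y\in L$, and that every finite subcomplex of $X$ collapses into $L$. Then $\pi_1(X,x)$ is locally indicable for every $x\in X$. -/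

import Mathlib

open Topology

/-- A group is locally indicable if every nontrivial finitely generated subgroup surjects
onto the infinite cyclic group. -/
def LocallyIndicable (G : Type*) [Group G] : Prop :=
  ∀ H : Subgroup G, H.FG → H ≠ ⊥ → ∃ f : H →* Multiplicative ℤ, Function.Surjective f

/-- A CW complex is a 2-complex if it has no cells of dimension greater than two. -/
def IsTwoComplex {X : Type*} [TopologicalSpace X] (C : Set X) [CWComplex C] : Prop :=
  ∀ n : ℕ, 2 < n → IsEmpty (RelCWComplex.cell C n)

/-- A subcomplex is finite if it consists of finitely many cells. -/
def IsFiniteSubcomplex {X : Type*} [TopologicalSpace X] {C : Set X} [CWComplex C]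
    (Z : RelCWComplex.Subcomplex C) : Prop :=
  Finite (Σ n : ℕ, Z.I n)

/-- `ElementaryCollapse Z Z'`: the subcomplex `Z` collapses to the subcomplex `Z'` in one step.
That is, `Z` consists of `Z'` and exactly two further open cells, an `(n + 1)`-cell `i` and an
`n`-cell `j` which is a free face of `i`: there is a characteristic map `φ` of the cell `i`,
defined on the cube `[-1, 1] ^ (n + 1)`, whose restriction to the face
`{1} × [-1, 1] ^ n` is a characteristic map of the cell `j`, and which sends the rest of the
boundary of the cube (all points outside the relative interior of that face) into `Z'`.
So the attaching map of the cell `i` runs over the cell `j` exactly once, and no other cell of `Z`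
has `j` in its boundary. In `Fin n → ℝ` with the maximum metric, `Metric.closedBall 0 1`,
`Metric.ball 0 1` and `Metric.sphere 0 1` are the cube, its interior and its boundary. (In a
Hausdorff space such bijections of open cubes onto open cells are homeomorphisms,
by compactness of the closed cubes.) -/
def ElementaryCollapse {X : Type*} [TopologicalSpace X] {C : Set X} [CWComplex C]
    (Z Z' : RelCWComplex.Subcomplex C) : Prop :=
  ∃ (n : ℕ) (i : RelCWComplex.cell C (n + 1)) (j : RelCWComplex.cell C n),
    (Z : Set X) = (Z' : Set X) ∪ RelCWComplex.openCell (C := C) n j ∪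
      RelCWComplex.openCell (C := C) (n + 1) i ∧
    Disjoint (Z' : Set X) (RelCWComplex.openCell (C := C) n j) ∧
    Disjoint (Z' : Set X) (RelCWComplex.openCell (C := C) (n + 1) i) ∧
    ∃ φ : (Fin (n + 1) → ℝ) → X,
      ContinuousOn φ (Metric.closedBall 0 1) ∧
      Set.BijOn φ (Metric.ball 0 1) (RelCWComplex.openCell (C := C) (n + 1) i) ∧
      Set.BijOn (fun y : Fin n → ℝ => φ (Matrix.vecCons 1 y)) (Metric.ball 0 1)
        (RelCWComplex.openCell (C := C) n j) ∧
      Set.MapsTo φ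
        (Metric.sphere 0 1 \ (fun y : Fin n → ℝ => Matrix.vecCons 1 y) '' Metric.ball 0 1)
        (Z' : Set X)

/-- `Z` collapses to `Z'` if `Z'` is obtained from `Z` by finitely many (possibly zero) elementary
collapses. -/
def CollapsesTo {X : Type*} [TopologicalSpace X] {C : Set X} [CWComplex C]
    (Z Z' : RelCWComplex.Subcomplex C) : Prop :=
  Relation.ReflTransGen ElementaryCollapse Z Z'

/-- `Z` collapses into `L` if it collapses to some subcomplex that is contained in `L`. -/
def CollapsesInto {X : Type*} [TopologicalSpace X] {C : Set X} [CWComplex C]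
    (Z L : RelCWComplex.Subcomplex C) : Prop :=
  ∃ Z' : RelCWComplex.Subcomplex C, Z' ≤ L ∧ CollapsesTo Z Z'

/-! Only finitely many relations of a finitely generated subgroup H of π₁(X) matter for maps to ℤ.
Write H as the image of a free group F on a finite set S, with kernel N. The image of N in the
abelianization of F is finitely generated, so some finite R ⊆ N has the property that every F → ℤ
killing R kills N (`Subgroup.exists_finite_subset_forall_hom_eq_one`). Loops for S and
null-homotopies for R fill a compact set, hence lie in a finite subcomplex Z. As Z collapses into L,
the inclusion Z → X is homotopic to some Z → L → X (`CollapsesInto.exists_homotopic`). The resulting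
θ : F → π₁(Z) → π₁(L) kills R, and ker θ ≤ N because Z → X factors through L up to homotopy. If H ≠
1, the image of θ is nontrivial, so it surjects onto ℤ; the composite F → ℤ kills R, hence N, and
descends to H. -/

/-! ### Compact sets and finite subcomplexes -/

namespace Topology.CWComplex

variable {X : Type*} [TopologicalSpace X] {C : Set X} [CWComplex C]

/-- The union of the open cells in a set of cells. -/
def openCells (F : Set (Σ n, cell C n)) : Set X := ⋃ c ∈ F, openCell c.1 c.2

theorem openCells_mono {F G : Set (Σ n, cell C n)} (h : F ⊆ G) : openCells F ⊆ openCells G :=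
  Set.biUnion_subset_biUnion_left h

/-- Every cell belongs to a finite set of cells that contains, with each cell, the cells meeting
its closure. -/
theorem exists_finite_cells_closed (n : ℕ) (i : cell C n) :
    ∃ F : Set (Σ n, cell C n), F.Finite ∧ ⟨n, i⟩ ∈ F ∧
      ∀ c ∈ F, closedCell c.1 c.2 ⊆ openCells F := by
  induction n using Nat.strong_induction_on with
  | _ n ih =>
    obtain ⟨I, hI⟩ := cellFrontier_subset_finite_closedCell n i
    choose G hGfin hGmem hG using ih
    let F : Set (Σ n, cell C n) :=
      insert ⟨n, i⟩ (⋃ m : Fin n, ⋃ j ∈ I m, G m m.2 j)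
    have hsub : ∀ (m : ℕ) (hm : m < n), ∀ j ∈ I m, G m hm j ⊆ F := fun m hm j hj c hc =>
      Or.inr (Set.mem_iUnion.2 ⟨⟨m, hm⟩, Set.mem_biUnion hj hc⟩)
    refine ⟨F, ?_, Set.mem_insert _ _, ?_⟩
    · have hfin : (⋃ m : Fin n, ⋃ j ∈ I m, G m m.2 j).Finite :=
        Set.finite_iUnion fun m => (I m).finite_toSet.biUnion fun j _ => hGfin m m.2 j
      exact hfin.insert _
    · intro c hc
      rcases hc with rfl | hc
      · rw [← RelCWComplex.cellFrontier_union_openCell_eq_closedCell]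
        refine Set.union_subset (hI.trans ?_) 
          (Set.subset_biUnion_of_mem (u := fun c : Σ n, cell C n => openCell c.1 c.2)
            (Set.mem_insert _ _))
        refine Set.iUnion₂_subset fun m hm => Set.iUnion₂_subset fun j hj => ?_
        exact (hG m hm j _ (hGmem m hm j)).trans (openCells_mono (hsub m hm j hj))
      · obtain ⟨m, hc⟩ := Set.mem_iUnion.1 hc
        obtain ⟨j, hj, hc⟩ := Set.mem_iUnion₂.1 hc
        exact (hG m m.2 j c hc).trans (openCells_mono (hsub m m.2 j hj))

variable [T2Space X]

/-- A compact subset of a CW complex meets only finitely many open cells. -/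
theorem finite_cells_of_isCompact {K : Set X} (hK : IsCompact K) (hKC : K ⊆ C) :
    {c : Σ n, cell C n | (openCell c.1 c.2 ∩ K).Nonempty}.Finite := by
  set T := {c : Σ n, cell C n | (openCell c.1 c.2 ∩ K).Nonempty} with hT
  rcases isEmpty_or_nonempty X with hX | hX
  · exact Set.Finite.subset Set.finite_empty fun c hc => hX.elim hc.some
  choose! p hp using fun c (hc : c ∈ T) => hc
  have hinj : Set.InjOn p T := fun c hc d hd hcd => RelCWComplex.eq_of_not_disjoint_openCell
    (Set.not_disjoint_iff.2 ⟨p c, (hp c hc).1, hcd ▸ (hp d hd).1⟩)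
  -- One point is chosen in each open cell met by `K`. A closed cell lies in finitely many open
  -- cells, so it contains finitely many chosen points. Hence every set of chosen points is closed,
  -- and their totality is compact and discrete.
  have hclosed : ∀ A ⊆ p '' T, IsClosed A := by
    intro A hA
    have hAC : A ⊆ C := fun y hy => by
      obtain ⟨c, hc, rfl⟩ := hA hy
      exact hKC (hp c hc).2
    refine (CWComplex.closed C A hAC).2 fun n j => Set.Finite.isClosed ?_
    obtain ⟨F, hF, hmem, hcl⟩ := exists_finite_cells_closed n j
    refine (hF.image p).subset ?_
    rintro y ⟨hyA, hy⟩
    obtain ⟨c, hc, rfl⟩ := hA hyA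
    obtain ⟨d, hd, hyd⟩ := Set.mem_iUnion₂.1 (hcl _ hmem hy)
    have hcd : c = d := RelCWComplex.eq_of_not_disjoint_openCell
      (Set.not_disjoint_iff.2 ⟨p c, (hp c hc).1, hyd⟩)
    exact hcd ▸ Set.mem_image_of_mem p hd
  have hcompact : IsCompact (p '' T) := hK.of_isClosed_subset (hclosed _ subset_rfl) <| by
    rintro _ ⟨c, hc, rfl⟩
    exact (hp c hc).2
  refine Set.Finite.of_finite_image (hcompact.finite ⟨discreteTopology_iff_forall_isClosed.2
    fun A => ?_⟩) hinj
  rw [← Set.preimage_image_eq A Subtype.val_injective]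
  exact (hclosed _ (by simp)).preimage continuous_subtype_val

/-- A compact subset of a CW complex is contained in a finite subcomplex. -/
theorem exists_finite_subcomplex_of_isCompact {K : Set X} (hK : IsCompact K) (hKC : K ⊆ C) :
    ∃ Z : RelCWComplex.Subcomplex C, IsFiniteSubcomplex Z ∧ K ⊆ Z := by
  choose G hGfin hGmem hG using fun c : Σ n, cell C n => exists_finite_cells_closed c.1 c.2
  have hT := finite_cells_of_isCompact hK hKC
  set T := {c : Σ n, cell C n | (openCell c.1 c.2 ∩ K).Nonempty}
  let F : Set (Σ n, cell C n) := ⋃ c ∈ T, G c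
  have hF : F.Finite := hT.biUnion fun c _ => hGfin c
  have hmem : ∀ n (i : {i : cell C n | (⟨n, i⟩ : Σ n, cell C n) ∈ F}),
      closedCell (C := C) n i ⊆ openCells F := by
    rintro n ⟨i, hi⟩
    obtain ⟨c, hc, hi⟩ := Set.mem_iUnion₂.1 hi
    exact (hG c _ hi).trans (openCells_mono (Set.subset_biUnion_of_mem hc))
  refine ⟨CWComplex.Subcomplex.mk' C (openCells F) (fun n => {i | ⟨n, i⟩ ∈ F}) hmem ?_, ?_, ?_⟩
  · ext y
    simp [openCells]
  · have := hF.to_subtype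
    refine Finite.of_injective (β := F) (fun c => ⟨⟨c.1, c.2.1⟩, c.2.2⟩) ?_
    rintro ⟨n, i, hi⟩ ⟨m, j, hj⟩ h
    cases h
    rfl
  · intro y hy
    have hyC := hKC hy
    rw [← CWComplex.iUnion_openCell_eq_complex (C := C)] at hyC
    obtain ⟨n, hy'⟩ := Set.mem_iUnion.1 hyC
    obtain ⟨i, hi⟩ := Set.mem_iUnion.1 hy'
    have hc : (⟨n, i⟩ : Σ n, cell C n) ∈ T := ⟨y, hi, hy⟩
    exact Set.mem_biUnion (Set.mem_biUnion hc (hGmem _)) hi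

end Topology.CWComplex

/-! ### Gluing a deformation along a quotient map -/

section Glue

open unitInterval

variable {X : Type*} [TopologicalSpace X]

/-- The inclusion of a subset into the ambient space. -/
def setInclusion (A : Set X) : C(A, X) := ⟨Subtype.val, continuous_subtype_val⟩

/-- If a set `A` consists of a closed set `B` and of the image of a compact set `K` that is
injective, and avoids `B`, off a subset `J ⊆ K` mapped into `B`, then a strong deformation
retraction of `K` to `J` induces a deformation of `A` into `B`. -/
theorem exists_homotopic_of_deformation {E : Type*} [TopologicalSpace E] [T2Space X] {A B : Set X}
    {K J : Set E} (hB : IsClosed B) (hK : IsCompact K) {φ : E → X} (hφ : ContinuousOn φ K)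
    (hA : A = B ∪ φ '' K) (hJ : Set.MapsTo φ (K ∩ J) B) (hinj : Set.InjOn φ (K \ J))
    (hdisj : ∀ e ∈ K \ J, φ e ∉ B) (D : I × E → E) (hD : ContinuousOn D (Set.univ ×ˢ K))
    (hDK : ∀ t, ∀ e ∈ K, D (t, e) ∈ K) (hD0 : ∀ e ∈ K, D (0, e) = e)
    (hD1 : ∀ e ∈ K, D (1, e) ∈ J) (hDJ : ∀ t, ∀ e ∈ K ∩ J, D (t, e) = e) :
    ∃ r : C(A, B), (setInclusion A).Homotopic ((setInclusion B).comp r) := by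
  have hBA : B ⊆ A := hA ▸ Set.subset_union_left
  have hKA : ∀ e : K, φ e ∈ A := fun e => hA ▸ Or.inr (Set.mem_image_of_mem φ e.2)
  have : CompactSpace K := isCompact_iff_compactSpace.1 hK
  have hφ' : Continuous fun e : K => φ e := hφ.domRestrict
  have hDφ : Continuous fun p : I × K => φ (D (p.1, p.2)) := by
    have hDc : Continuous fun p : I × K => D (p.1, p.2) :=
      hD.comp_continuous (by fun_prop) fun p => ⟨trivial, p.2.2⟩
    exact hφ.comp_continuous hDc fun p => hDK p.1 p.2 p.2.2
  have hfix : ∀ t, ∀ e ∈ K, φ e ∈ B → φ (D (t, e)) = φ e := fun t e he heB => by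
    rw [hDJ t e ⟨he, by_contra fun heJ => hdisj e ⟨he, heJ⟩ heB⟩]
  -- The homotopy is to be constant on `B` and `φ ∘ D` on `K`. It descends to `I × A` because `q` is
  -- assembled from two proper maps, hence closed, hence a quotient map.
  let q : (I × B) ⊕ (I × K) → I × A :=
    Sum.elim (Prod.map id (Set.inclusion hBA)) (Prod.map id fun e => ⟨φ e, hKA e⟩)
  have hqB : IsProperMap (Prod.map (id : I → I) (Set.inclusion hBA)) :=
    isProperMap_id.prodMap
      (IsClosedEmbedding.inclusion hBA (hB.preimage continuous_subtype_val)).isProperMap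
  have hqK : IsProperMap (Prod.map (id : I → I) fun e : K => (⟨φ e, hKA e⟩ : A)) :=
    isProperMap_id.prodMap (hφ'.subtype_mk hKA).isProperMap
  have hqs : Function.Surjective q := by
    rintro ⟨t, a, ha⟩
    rcases hA ▸ ha with ha' | ⟨e, he, rfl⟩
    · exact ⟨Sum.inl (t, ⟨a, ha'⟩), rfl⟩
    · exact ⟨Sum.inr (t, ⟨e, he⟩), rfl⟩
  have hq : IsQuotientMap q := IsClosedMap.isQuotientMap
    (hqB.isClosedMap.sumElim hqK.isClosedMap) (hqB.continuous.sumElim hqK.continuous) hqs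
  let h : C((I × B) ⊕ (I × K), X) :=
    ⟨Sum.elim (fun p => p.2) fun p => φ (D (p.1, p.2)), Continuous.sumElim (by fun_prop) hDφ⟩
  -- Points with a common image in `B` come from `B` or `J`, where nothing moves; off `B`,
  -- injectivity of `φ` on `K \ J` leaves no identification.
  have hfac : Function.FactorsThrough h q := by
    have key : ∀ (t : I) (b : B) (e : K), (b : X) = φ e → (b : X) = φ (D (t, e)) :=
      fun t b e hbe => by rw [hfix t e e.2 (hbe ▸ b.2), hbe]
    rintro (⟨t, b⟩ | ⟨t, e⟩) (⟨t', b'⟩ | ⟨t', e'⟩) heq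
    all_goals
      obtain ⟨rfl, hval⟩ := Prod.mk.inj heq
      replace hval := congrArg Subtype.val hval
    · exact hval
    · exact key _ _ _ hval
    · exact (key _ _ _ hval.symm).symm
    · change φ (D (t, e)) = φ (D (t, e'))
      replace heq : φ e = φ e' := hval
      by_cases he : φ e ∈ B
      · rw [hfix t e e.2 he, hfix t e' e'.2 (heq ▸ he), heq]
      · have hne : ∀ x : K, φ x ∉ B → (x : E) ∈ K \ J :=
          fun x hx => ⟨x.2, fun hxJ => hx (hJ ⟨x.2, hxJ⟩)⟩
        rw [hinj (hne e he) (hne e' (heq ▸ he)) heq]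
  let G : C(I × A, X) := IsQuotientMap.lift (f := ⟨q, hq.continuous⟩) hq h hfac
  have hG : ∀ s, G (q s) = h s := fun s =>
    DFunLike.congr_fun (IsQuotientMap.lift_comp (f := ⟨q, hq.continuous⟩) hq h hfac) s
  have hG1 : ∀ a : A, G (1, a) ∈ B := fun a => by
    obtain ⟨a, ha⟩ := a
    rcases hA ▸ ha with ha' | ⟨e, he, rfl⟩
    · exact (hG (Sum.inl (1, ⟨a, ha'⟩))).symm ▸ ha'
    · exact (hG (Sum.inr (1, ⟨e, he⟩))).symm ▸ hJ ⟨hDK 1 e he, hD1 e he⟩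
  have hG0 : ∀ a : A, G (0, a) = a := fun a => by
    obtain ⟨a, ha⟩ := a
    rcases hA ▸ ha with ha' | ⟨e, he, rfl⟩
    · exact hG (Sum.inl (0, ⟨a, ha'⟩))
    · exact (hG (Sum.inr (0, ⟨e, he⟩))).trans (congrArg φ (hD0 e he))
  exact ⟨⟨fun a => ⟨G (1, a), hG1 a⟩, by fun_prop⟩,
    ⟨⟨G, hG0, fun a => rfl⟩⟩⟩

end Glue

/-! ### Retraction of the cube onto its boundary minus an open face -/

section Cube

open unitInterval Metric

variable {n : ℕ}

/-- The boundary of the cube `[-1, 1] ^ (n + 1)` without the relative interior of the face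
`{1} × [-1, 1] ^ n`. -/
def cubeHorn (n : ℕ) : Set (Fin (n + 1) → ℝ) := {x | x 0 = -1 ∨ ‖Matrix.vecTail x‖ = 1}

theorem norm_vecCons (a : ℝ) (y : Fin n → ℝ) : ‖Matrix.vecCons a y‖ = max |a| ‖y‖ := by
  refine le_antisymm ((pi_norm_le_iff_of_nonneg (by positivity)).2 fun i => ?_) (max_le ?_ ?_)
  · refine Fin.cases ?_ (fun j => ?_) i
    · exact le_max_left _ _
    · exact (norm_le_pi_norm y j).trans (le_max_right _ _)
  · exact norm_le_pi_norm (Matrix.vecCons a y) 0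
  · exact (pi_norm_le_iff_of_nonneg (norm_nonneg _)).2 fun j =>
      norm_le_pi_norm (Matrix.vecCons a y) j.succ

theorem mem_closedBall_iff_head_tail {x : Fin (n + 1) → ℝ} :
    x ∈ closedBall 0 1 ↔ |x 0| ≤ 1 ∧ ‖Matrix.vecTail x‖ ≤ 1 := by
  rw [mem_closedBall_zero_iff, ← Matrix.cons_head_tail x, norm_vecCons, max_le_iff]
  rfl

/-- The factor by which the projection from `(3, 0)` to `cubeHorn n` scales. -/
noncomputable def hornScale (x : Fin (n + 1) → ℝ) : ℝ :=
  -- On the ray from (3, 0) through `x`, the scale `s` reaches the face with head -1 when `s * (3 -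
  -- x 0) = 4`, and the side walls when `s * ‖tail‖ = 1`; the smaller `s` is the exit from the cube.
  -- Any centre (c, 0) with c > 1 would serve, with c + 1 in place of 4.
  (max ((3 - x 0) / 4) ‖Matrix.vecTail x‖)⁻¹

/-- The projection of the cube to `cubeHorn n` from the point `(3, 0)`. -/
noncomputable def hornProjection (x : Fin (n + 1) → ℝ) : Fin (n + 1) → ℝ :=
  Matrix.vecCons (3 - hornScale x * (3 - x 0)) (hornScale x • Matrix.vecTail x)

theorem max_pos_of_mem_closedBall {x : Fin (n + 1) → ℝ} (hx : x ∈ closedBall 0 1) :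
    0 < max ((3 - x 0) / 4) ‖Matrix.vecTail x‖ := by
  have := (abs_le.1 (mem_closedBall_iff_head_tail.1 hx).1).2
  exact lt_max_of_lt_left (by linarith)

theorem continuousOn_hornProjection :
    ContinuousOn (hornProjection (n := n)) (closedBall 0 1) := by
  have htail : Continuous fun x : Fin (n + 1) → ℝ => Matrix.vecTail x := by
    unfold Matrix.vecTail
    fun_prop
  have hscale : ContinuousOn (hornScale (n := n)) (closedBall 0 1) :=
    ContinuousOn.inv₀ (by fun_prop) fun x hx => (max_pos_of_mem_closedBall hx).ne'
  refine continuousOn_pi.2 fun i => Fin.cases ?_ (fun j => ?_) i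
  · exact continuousOn_const.sub (hscale.mul (by fun_prop))
  · exact hscale.mul (((continuous_apply j).comp htail).continuousOn)

theorem hornProjection_mem {x : Fin (n + 1) → ℝ} (hx : x ∈ closedBall 0 1) :
    hornProjection x ∈ closedBall 0 1 ∧ hornProjection x ∈ cubeHorn n := by
  have hm := max_pos_of_mem_closedBall hx
  obtain ⟨h0, h1⟩ := mem_closedBall_iff_head_tail.1 hx
  rw [abs_le] at h0
  set m := max ((3 - x 0) / 4) ‖Matrix.vecTail x‖ with hmdef
  have hm1 : m ≤ 1 := max_le (by linarith) h1
  have hs : hornScale x = m⁻¹ := rfl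
  -- A scale of at least 1 moves away from (3, 0), so the head coordinate does not increase and
  -- stays at most 1.
  have hs1 : 1 ≤ m⁻¹ := (one_le_inv₀ hm).2 hm1
  have hsm : m⁻¹ * m = 1 := inv_mul_cancel₀ hm.ne'
  have ha : (3 - x 0) / 4 ≤ m := le_max_left _ _
  have hb : ‖Matrix.vecTail x‖ ≤ m := le_max_right _ _
  have hhead : hornProjection x 0 = 3 - m⁻¹ * (3 - x 0) := rfl
  have htail : ‖Matrix.vecTail (hornProjection x)‖ = m⁻¹ * ‖Matrix.vecTail x‖ := by
    change ‖m⁻¹ • Matrix.vecTail x‖ = _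
    rw [norm_smul, Real.norm_of_nonneg (inv_nonneg.2 hm.le)]
  refine ⟨mem_closedBall_iff_head_tail.2 ⟨?_, ?_⟩, ?_⟩
  · rw [hhead, abs_le]
    constructor <;> nlinarith
  · rw [htail]
    nlinarith
  · rcases max_choice ((3 - x 0) / 4) ‖Matrix.vecTail x‖ with h | h
    · refine Or.inl ?_
      rw [hhead]
      rw [← hmdef] at h
      linear_combination (-4 : ℝ) * hsm + 4 * m⁻¹ * h
    · refine Or.inr ?_
      rw [htail, ← h, ← hmdef, hsm]

theorem hornProjection_eq_self {x : Fin (n + 1) → ℝ} (hx : x ∈ closedBall 0 1)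
    (hxJ : x ∈ cubeHorn n) : hornProjection x = x := by
  obtain ⟨h0, h1⟩ := mem_closedBall_iff_head_tail.1 hx
  rw [abs_le] at h0
  have hs : hornScale x = 1 := by
    rw [hornScale, inv_eq_one]
    rcases hxJ with h | h
    · rw [h, max_eq_left (by linarith)]
      norm_num
    · rw [h, max_eq_right (by linarith)]
  rw [hornProjection, hs, one_smul, one_mul, sub_sub_cancel]
  exact Matrix.cons_head_tail x

/-- The deformation retraction of the cube to `cubeHorn n` along the lines through `(3, 0)`. -/
noncomputable def hornDeformation (p : I × (Fin (n + 1) → ℝ)) : Fin (n + 1) → ℝ :=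
  (1 - (p.1 : ℝ)) • p.2 + (p.1 : ℝ) • hornProjection p.2

theorem continuousOn_hornDeformation :
    ContinuousOn (hornDeformation (n := n)) (Set.univ ×ˢ closedBall 0 1) := by
  have : ContinuousOn (fun p : I × (Fin (n + 1) → ℝ) => hornProjection p.2)
      (Set.univ ×ˢ closedBall 0 1) :=
    continuousOn_hornProjection.comp continuousOn_snd fun p hp => hp.2
  unfold hornDeformation
  fun_prop

theorem hornDeformation_mem (t : I) {x : Fin (n + 1) → ℝ} (hx : x ∈ closedBall 0 1) :
    hornDeformation (t, x) ∈ closedBall 0 1 :=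
  (convex_closedBall 0 1) hx (hornProjection_mem hx).1 (sub_nonneg.2 t.2.2) t.2.1 (by simp)

theorem hornDeformation_eq_self (t : I) {x : Fin (n + 1) → ℝ} (hx : x ∈ closedBall 0 1)
    (hxJ : x ∈ cubeHorn n) : hornDeformation (t, x) = x := by
  simp only [hornDeformation, hornProjection_eq_self hx hxJ, ← add_smul, sub_add_cancel, one_smul]

theorem mem_sphere_diff_face_of_mem_cubeHorn {x : Fin (n + 1) → ℝ} (hx : x ∈ closedBall 0 1)
    (hxJ : x ∈ cubeHorn n) :
    x ∈ sphere 0 1 \ (fun y : Fin n → ℝ => Matrix.vecCons 1 y) '' ball 0 1 := by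
  constructor
  · rw [mem_sphere_zero_iff_norm]
    refine le_antisymm (mem_closedBall_zero_iff.1 hx) ?_
    rw [← Matrix.cons_head_tail x, norm_vecCons]
    rcases hxJ with h | h
    · exact le_max_of_le_left (by rw [Matrix.vecHead, h]; norm_num)
    · exact le_max_of_le_right h.ge
  · rintro ⟨y, hy, rfl⟩
    rcases hxJ with h | h
    · norm_num at h
    · rw [Matrix.tail_cons] at h
      exact (mem_ball_zero_iff.1 hy).ne h

/-- Off the horn the tail has norm below 1 and the head is not -1, so the boundary can be met only
at head 1. -/
theorem mem_ball_or_face_of_notMem_cubeHorn {x : Fin (n + 1) → ℝ} (hx : x ∈ closedBall 0 1)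
    (hxJ : x ∉ cubeHorn n) :
    x ∈ ball 0 1 ∨ ∃ y : Fin n → ℝ, y ∈ ball 0 1 ∧ Matrix.vecCons 1 y = x := by
  obtain ⟨h0, h1⟩ := mem_closedBall_iff_head_tail.1 hx
  rw [cubeHorn, Set.mem_ofPred_eq, not_or] at hxJ
  have ht : ‖Matrix.vecTail x‖ < 1 := lt_of_le_of_ne h1 hxJ.2
  by_cases h : x 0 = 1
  · refine Or.inr ⟨Matrix.vecTail x, mem_ball_zero_iff.2 ht, ?_⟩
    rw [← h]
    exact Matrix.cons_head_tail x
  · refine Or.inl ?_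
    rw [mem_ball_zero_iff, ← Matrix.cons_head_tail x, norm_vecCons]
    refine max_lt (lt_of_le_of_ne h0 fun h' => ?_) ht
    rcases (abs_eq zero_le_one).1 h' with h' | h'
    exacts [h h', hxJ.1 h']

end Cube

/-! ### Collapses as deformations -/

section Collapse

open Metric

variable {X : Type*} [TopologicalSpace X] [T2Space X] {C : Set X} [CWComplex C]

/-- The map `φ` transports the retraction of the cube onto its horn. It is injective off the horn
because it is injective on the open cube and on the free face, whose images are disjoint open cells.
-/
theorem ElementaryCollapse.exists_homotopic {Z Z' : RelCWComplex.Subcomplex C}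
    (h : ElementaryCollapse Z Z') : ∃ r : C((Z : Set X), (Z' : Set X)),
      (setInclusion (Z : Set X)).Homotopic ((setInclusion (Z' : Set X)).comp r) := by
  obtain ⟨n, i, j, hZ, hj, hi, φ, hφ, hball, hface, hJ⟩ := h
  have hcell : Disjoint (RelCWComplex.openCell (C := C) (n + 1) i)
      (RelCWComplex.openCell (C := C) n j) :=
    RelCWComplex.disjoint_openCell_of_ne fun h => n.succ_ne_self (congrArg Sigma.fst h)
  have hJ' : Set.MapsTo φ (closedBall 0 1 ∩ cubeHorn n) (Z' : Set X) := fun x hx =>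
    hJ (mem_sphere_diff_face_of_mem_cubeHorn hx.1 hx.2)
  have hmem := fun x (hx : x ∈ closedBall 0 1 \ cubeHorn n) =>
    mem_ball_or_face_of_notMem_cubeHorn hx.1 hx.2
  refine exists_homotopic_of_deformation Z'.closed (isCompact_closedBall 0 1) hφ ?_ hJ' ?_ ?_
    hornDeformation continuousOn_hornDeformation (fun t x hx => hornDeformation_mem t hx) ?_ ?_
    fun t x hx => hornDeformation_eq_self t hx.1 hx.2
  · rw [hZ]
    apply Set.Subset.antisymm
    · refine Set.union_subset (Set.union_subset Set.subset_union_left ?_) ?_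
      · rw [← hface.image_eq]
        rintro _ ⟨y, hy, rfl⟩
        refine Or.inr (Set.mem_image_of_mem φ (mem_closedBall_iff_head_tail.2 ⟨by simp, ?_⟩))
        exact (mem_ball_zero_iff.1 hy).le
      · rw [← hball.image_eq]
        exact Set.subset_union_of_subset_right (Set.image_mono ball_subset_closedBall) _
    · refine Set.union_subset (Set.subset_union_left.trans Set.subset_union_left) ?_
      rintro _ ⟨x, hx, rfl⟩
      by_cases hxJ : x ∈ cubeHorn n
      · exact Or.inl (Or.inl (hJ' ⟨hx, hxJ⟩))
      · rcases hmem x ⟨hx, hxJ⟩ with hx' | ⟨y, hy, rfl⟩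
        · exact Or.inr (hball.mapsTo hx')
        · exact Or.inl (Or.inr (hface.mapsTo hy))
  · intro x hx x' hx' heq
    rcases hmem x hx with hxb | ⟨y, hy, rfl⟩ <;> rcases hmem x' hx' with hxb' | ⟨y', hy', rfl⟩
    · exact hball.injOn hxb hxb' heq
    · exact (hcell.ne_of_mem (hball.mapsTo hxb) (hface.mapsTo hy') heq).elim
    · exact (hcell.ne_of_mem (hball.mapsTo hxb') (hface.mapsTo hy) heq.symm).elim
    · rw [hface.injOn hy hy' heq]
  · intro x hx hxZ
    rcases hmem x hx with hxb | ⟨y, hy, rfl⟩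
    · exact Set.disjoint_left.1 hi hxZ (hball.mapsTo hxb)
    · exact Set.disjoint_left.1 hj hxZ (hface.mapsTo hy)
  · intro x _
    simp [hornDeformation]
  · intro x hx
    simpa [hornDeformation] using (hornProjection_mem hx).2

/-- All homotopies are between maps into `X`, so those of successive collapses compose; at the end
stands an inclusion into `L`. -/
theorem CollapsesInto.exists_homotopic {Z L : RelCWComplex.Subcomplex C}
    (h : CollapsesInto Z L) : ∃ r : C((Z : Set X), (L : Set X)),
      (setInclusion (Z : Set X)).Homotopic ((setInclusion (L : Set X)).comp r) := by
  obtain ⟨Z', hZ', h⟩ := h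
  induction h using Relation.ReflTransGen.head_induction_on with
  | refl => exact ⟨⟨Set.inclusion hZ', continuous_inclusion hZ'⟩, .refl _⟩
  | head hstep _ ih =>
    obtain ⟨r, hr⟩ := hstep.exists_homotopic
    obtain ⟨s, hs⟩ := ih
    exact ⟨s.comp r, hr.trans (hs.comp (.refl r))⟩

end Collapse

-- Local indicability from finitely many relations

universe u

/-- Homomorphisms to ℤ factor through the abelianization, a Noetherian ℤ-module, where the span of
the image of `N` is generated by finitely many images of elements of `N`. The subgroup `N` itself
need not be finitely generated. -/
theorem Subgroup.exists_finite_subset_forall_hom_eq_one {F : Type*} [Group F] [Group.FG F]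
    (N : Subgroup F) : ∃ R : Finset F, (R : Set F) ⊆ N ∧
      ∀ g : F →* Multiplicative ℤ, (∀ r ∈ R, g r = 1) → ∀ r ∈ N, g r = 1 := by
  classical
  have : Group.FG (Abelianization F) :=
    Group.fg_of_surjective (f := Abelianization.of) (QuotientGroup.mk'_surjective _)
  have : Module.Finite ℤ (Additive (Abelianization F)) :=
    Module.Finite.iff_addGroup_fg.2 inferInstance
  let a : F → Additive (Abelianization F) := fun x => Additive.ofMul (Abelianization.of x)
  obtain ⟨T, hT, hspan⟩ := Submodule.fg_span_iff_fg_span_finset_subset _ |>.1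
    (IsNoetherian.noetherian (Submodule.span ℤ (a '' N)))
  obtain ⟨R, hR, rfl⟩ := Finset.subset_set_image_iff.1 hT
  refine ⟨R, hR, fun g hg r hr => ?_⟩
  let l : Additive (Abelianization F) →ₗ[ℤ] ℤ :=
    (MonoidHom.toAdditiveLeft (Abelianization.lift g)).toIntLinearMap
  have hl : Submodule.span ℤ (a '' N) ≤ LinearMap.ker l := by
    rw [hspan, Submodule.span_le]
    intro y hy
    obtain ⟨s, hs, rfl⟩ := Finset.mem_image.1 (Finset.mem_coe.1 hy)
    exact congrArg Multiplicative.toAdd (hg s hs)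
  exact congrArg Multiplicative.ofAdd
    (hl (Submodule.subset_span (Set.mem_image_of_mem a hr)) : l (a r) = 0)

/-- A group is locally indicable as soon as every finite system of relations between finitely many
of its elements is satisfied by a system of elements of a locally indicable group that fulfils no
further relations. -/
theorem LocallyIndicable.of_finite_relations {Γ : Type u} [Group Γ]
    (h : ∀ (S : Set Γ), S.Finite → ∀ R : Finset (FreeGroup S),
      (∀ r ∈ R, FreeGroup.lift (Subtype.val : S → Γ) r = 1) →
      ∃ (Q : Type u) (_ : Group Q) (θ : FreeGroup S →* Q), LocallyIndicable Q ∧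
        (∀ r ∈ R, θ r = 1) ∧ ∀ w, θ w = 1 → FreeGroup.lift (Subtype.val : S → Γ) w = 1) :
    LocallyIndicable Γ := by
  intro H hH hne
  obtain ⟨S, rfl⟩ := hH
  set ψ : FreeGroup (S : Set Γ) →* Γ := FreeGroup.lift (Subtype.val : ↥(S : Set Γ) → Γ) with hψ
  have hrange : ψ.range = Subgroup.closure (S : Set Γ) := by
    rw [hψ, FreeGroup.range_lift_eq_closure, Subtype.range_coe]
  rw [← hrange] at hne ⊢
  obtain ⟨R, hRker, hR⟩ := ψ.ker.exists_finite_subset_forall_hom_eq_one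
  obtain ⟨Q, _, θ, hQ, hRθ, hθ⟩ := h S S.finite_toSet R fun r hr => hRker hr
  have hθne : θ.range ≠ ⊥ := by
    intro hbot
    refine hne ((MonoidHom.range_eq_bot_iff).2 (MonoidHom.ext fun w => ?_))
    refine hθ w ?_
    rw [(MonoidHom.range_eq_bot_iff).1 hbot, MonoidHom.one_apply]
  obtain ⟨f, hf⟩ := hQ θ.range ((Group.fg_iff_subgroup_fg _).1 inferInstance) hθne
  let g : FreeGroup (S : Set Γ) →* Multiplicative ℤ := f.comp θ.rangeRestrict
  have hg : Function.Surjective g := hf.comp θ.rangeRestrict_surjective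
  -- There need be no map from the subgroup to `Q`: `g` descends only because its target is ℤ, so
  -- that killing `R` suffices to kill all of `ψ.ker`.
  have hker : ψ.rangeRestrict.ker ≤ g.ker := by
    rw [MonoidHom.ker_rangeRestrict]
    refine fun w hw => hR g (fun r hr => ?_) w hw
    have : θ.rangeRestrict r = 1 := Subtype.ext (hRθ r hr)
    simp [g, this]
  refine ⟨ψ.rangeRestrict.liftOfSurjective ψ.rangeRestrict_surjective ⟨g, hker⟩, fun z => ?_⟩
  obtain ⟨w, rfl⟩ := hg z
  exact ⟨ψ.rangeRestrict w, ψ.rangeRestrict.liftOfRightInverse_comp_apply _ _ ⟨g, hker⟩ w⟩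

/-! ### Fundamental groups: homotopy invariance and compact supports -/

section

open CategoryTheory

variable {X Y W : Type*} [TopologicalSpace X] [TopologicalSpace Y] [TopologicalSpace W]

theorem FundamentalGroup.map_map (g : C(Y, W)) (f : C(X, Y)) (x : X) (α : FundamentalGroup X x) :
    FundamentalGroup.map g (f x) (FundamentalGroup.map f x α) =
      FundamentalGroup.map (g.comp f) x α := by
  induction α using Quotient.inductionOn
  rfl

/-- A free homotopy may move the base point, so the induced maps agree only up to transport along
its track; this does not affect triviality. In the fundamental groupoid this is naturality followed
by cancelling an isomorphism. -/
theorem ContinuousMap.Homotopic.fundamentalGroup_map_eq_one {f g : C(X, Y)} (h : f.Homotopic g)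
    {x : X} {α : FundamentalGroup X x} (hα : FundamentalGroup.map g x α = 1) :
    FundamentalGroup.map f x α = 1 := by
  obtain ⟨H⟩ := h
  have hnat := (FundamentalGroupoidFunctor.homotopicMapsNatIso H).naturality α
  have hg : (FundamentalGroupoid.map g).map α = 𝟙 _ := hα
  rw [hg, Category.comp_id] at hnat
  exact (cancel_mono ((FundamentalGroupoidFunctor.homotopicMapsNatIso H).app ⟨x⟩)).1
    (hnat.trans (Category.id_comp _).symm)

/-- An element of the fundamental group of a subset that dies in the ambient space already dies in
the union of the subset with a compact set. -/
theorem exists_isCompact_fundamentalGroup_map_eq_one {A : Set X} {a : A}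
    {α : FundamentalGroup A a} (hα : FundamentalGroup.map (setInclusion A) a α = 1) :
    ∃ K : Set X, IsCompact K ∧ ∀ (B : Set X) (hAB : A ⊆ B), K ⊆ B →
      FundamentalGroup.map ⟨Set.inclusion hAB, continuous_inclusion hAB⟩ a α = 1 := by
  obtain ⟨p, rfl⟩ := Quotient.exists_rep α
  have hp : (p.map (setInclusion A).continuous).Homotopic (Path.refl _) := Quotient.exact hα
  obtain ⟨H⟩ := hp
  refine ⟨Set.range H, isCompact_range H.continuous, fun B hAB hK => Quotient.sound ⟨?_⟩⟩
  exact
    { toFun := fun s => ⟨H s, hK (Set.mem_range_self s)⟩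
      continuous_toFun := by fun_prop
      map_zero_left := fun t => Subtype.ext (H.map_zero_left t)
      map_one_left := fun t => Subtype.ext (H.map_one_left t)
      prop' := fun t s hs => Subtype.ext (H.prop' t s hs) }

/-- Finitely many elements of the fundamental group lie in the image of the fundamental group of a
compact subset. -/
theorem exists_isCompact_lift_fundamentalGroup {x : X} {S : Set (FundamentalGroup X x)}
    (hS : S.Finite) : ∃ (K : Set X) (hx : x ∈ K), IsCompact K ∧
      ∃ l : S → FundamentalGroup K ⟨x, hx⟩,
        ∀ s, FundamentalGroup.map (setInclusion K) ⟨x, hx⟩ (l s) = s.1 := by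
  have := hS.to_subtype
  choose p hp using fun s : S => Quotient.exists_rep s.1
  -- The point `x` is added so that the base point lies in `K` even when `S` is empty.
  let K : Set X := insert x (⋃ s, Set.range (p s))
  have hK : ∀ s t, p s t ∈ K := fun s t => Or.inr (Set.mem_iUnion.2 ⟨s, Set.mem_range_self t⟩)
  refine ⟨K, Set.mem_insert _ _, ?_, fun s => ⟦⟨⟨fun t => ⟨p s t, hK s t⟩, by fun_prop⟩,
    Subtype.ext (p s).source, Subtype.ext (p s).target⟩⟧, fun s => ?_⟩
  · exact (isCompact_iUnion fun s => isCompact_range (p s).continuous).insert x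
  · rw [← hp s]
    rfl

end

theorem mainTheorem10 {X : Type*} [TopologicalSpace X] [T2Space X]
    [CWComplex (Set.univ : Set X)] (hX : IsTwoComplex (Set.univ : Set X))
    (L : RelCWComplex.Subcomplex (Set.univ : Set X))
    (hL : ∀ x : L, LocallyIndicable (FundamentalGroup L x))
    (hcollapse : ∀ Z : RelCWComplex.Subcomplex (Set.univ : Set X),
      IsFiniteSubcomplex Z → CollapsesInto Z L) :
    ∀ x : X, LocallyIndicable (FundamentalGroup X x) := by
  intro x
  refine LocallyIndicable.of_finite_relations fun S hS R hR => ?_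
  obtain ⟨A, hxA, hA, l, hl⟩ := exists_isCompact_lift_fundamentalGroup hS
  have hlift : ∀ w, FundamentalGroup.map (setInclusion A) ⟨x, hxA⟩ (FreeGroup.lift l w) =
      FreeGroup.lift (Subtype.val : S → FundamentalGroup X x) w := fun w => by
    have hcomp : (FundamentalGroup.map (setInclusion A) ⟨x, hxA⟩).comp (FreeGroup.lift l) =
        FreeGroup.lift (Subtype.val : S → FundamentalGroup X x) :=
      FreeGroup.ext_hom _ _ fun s => by
        rw [MonoidHom.comp_apply, FreeGroup.lift_apply_of]
        exact (hl s).trans (FreeGroup.lift_apply_of).symm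
    exact DFunLike.congr_fun hcomp w
  choose! K hK hKB using fun r (hr : r ∈ R) =>
    exists_isCompact_fundamentalGroup_map_eq_one ((hlift r).trans (hR r hr))
  -- One finite subcomplex holds the loops representing `S` and the null-homotopies of all relations
  -- in `R`.
  obtain ⟨Z, hZ, hsub⟩ := CWComplex.exists_finite_subcomplex_of_isCompact
    (hA.union (R.isCompact_biUnion hK)) (Set.subset_univ _)
  have hAZ : A ⊆ (Z : Set X) := Set.subset_union_left.trans hsub
  obtain ⟨f, hf⟩ := (hcollapse Z hZ).exists_homotopic
  let ι : C(A, (Z : Set X)) := ⟨Set.inclusion hAZ, continuous_inclusion hAZ⟩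
  refine ⟨FundamentalGroup L (f (ι ⟨x, hxA⟩)), inferInstance,
    ((FundamentalGroup.map f _).comp (FundamentalGroup.map ι _)).comp (FreeGroup.lift l),
    hL _, fun r hr => ?_, fun w hw => ?_⟩
  · have h1 : FundamentalGroup.map ι _ (FreeGroup.lift l r) = 1 := hKB r hr (Z : Set X) hAZ
      (((Set.subset_biUnion_of_mem (u := K) hr).trans Set.subset_union_right).trans hsub)
    rw [MonoidHom.comp_apply, MonoidHom.comp_apply, h1, map_one]
  · rw [MonoidHom.comp_apply, MonoidHom.comp_apply] at hw
    -- A word dying in π₁(L) dies in π₁(X) along Z → L → X, hence also along the homotopic inclusion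
    -- Z → X.
    have h1 : FundamentalGroup.map ((setInclusion (L : Set X)).comp f) _
        (FundamentalGroup.map ι ⟨x, hxA⟩ (FreeGroup.lift l w)) = 1 := by
      rw [← FundamentalGroup.map_map]
      exact (congrArg _ hw).trans (map_one _)
    have h2 := hf.fundamentalGroup_map_eq_one h1
    rw [FundamentalGroup.map_map] at h2
    exact (hlift w).symm.trans h2
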